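/- All graphs are finite and simple, and $\log$ is the natural logarithm. For a finite graph $F$ and $\lambda>0$ let $Z_F(\lambda)=\sum_{I}\lambda^{|I|}$, where $I$ ranges over all independent sets of $F$ (including $\varnothing$), be the partition function of the hard-core model on $F$ at fugacity $\lambda$, and let $Z_F'$ be its derivative in $\lambda$. For a graph $G$ and a vertex $u$ let $G[N(u)]$ be the subgraph induced by the neighbours of $u$. The hard-core model on $G$ at fugacity $\lambda$ has strong local $(\beta,\gamma)$-occupancy if, for every vertex $u$ of $G$ and every subgraph $F\subseteq G[N(u)]$ (not necessarily induced, possibly with no vertices), $$\beta\,\frac{\lambda}{1+\lambda}\,\frac{1}{Z_F(\lambda)}+\gamma\,\frac{\lambda Z_F'(\lambda)}{Z_F(\lambda)}\ \ge\ 1 .$$ The list chromatic number of $G$ is the least integer $k$ such that, whenever every vertex $v$ is given a list $L(v)$ of exactly $k$ natural numbers, $G$ has a proper colouring in which each vertex $v$ receives a colour from $L(v)$. Theorem. Let $G$ be a graph of maximum degree $\Delta\ge 2^6$ such that the hard-core model on $G$ at fugacity $\lambda$ has strong local $(\beta,\gamma)$-occupancy for some $\lambda,\beta,\gamma>0$.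 Suppose that there is a real number $\ell>7\log\Delta$ such that $Z_F(\lambda)\ge 8\Delta^4$ for every vertex $u$ of $G$ and every subgraph $F\subseteq G[N(u)]$ with at least $\ell/8$ vertices. Then the list chromatic number of $G$ is at most $q$, where $$q=r\left(\beta+\gamma\frac{\Delta}{r}\right)\qquad\text{and}\qquad r=\frac{\lambda}{1+\lambda}\cdot\frac{\ell}{1-\sqrt{7(\log\Delta)/\ell}} .$$ -/

import Mathlib

namespace HardCore

open Classical in
/-- The partition function `Z_G(lam) = ∑ lam ^ |I|`, summed over all independent sets `I` of `G`
(the empty set included), of the hard-core model on the finite graph `G` at fugacity `lam`. -/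
noncomputable def partitionFunction {V : Type*} [Fintype V] (G : SimpleGraph V) (lam : ℝ) : ℝ :=
  ∑ I ∈ Finset.univ.filter (fun I : Finset V => G.IsIndepSet (I : Set V)), lam ^ I.card

open Classical in
/-- The hard-core model on `G` at fugacity `lam` has strong local `(β, γ)`-occupancy: for every
vertex `u` and every (not necessarily induced, possibly empty) subgraph `F` of the graph `G[N(u)]`
induced by the neighbourhood of `u`,
`β * (lam / (1 + lam)) * (1 / Z_F(lam)) + γ * (lam * Z_F'(lam) / Z_F(lam)) ≥ 1`. -/
def StrongLocalOccupancy {V : Type*} [Fintype V] (G : SimpleGraph V) (lam β γ : ℝ) : Prop :=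
  ∀ (u : V) (F : (G.induce (G.neighborSet u)).Subgraph),
    1 ≤ β * (lam / (1 + lam)) * (1 / partitionFunction F.coe lam)
      + γ * (lam * deriv (partitionFunction F.coe) lam / partitionFunction F.coe lam)

open Classical in
/-- For every vertex `u`, every subgraph `F` of `G[N(u)]` with at least `s` vertices satisfies
`Z_F(lam) ≥ M`. -/
def NeighborhoodPartitionBound {V : Type*} [Fintype V] (G : SimpleGraph V) (lam s M : ℝ) : Prop :=
  ∀ (u : V) (F : (G.induce (G.neighborSet u)).Subgraph),
    s ≤ (Fintype.card F.verts : ℝ) → M ≤ partitionFunction F.coe lam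

/-- Every `k`-list assignment `L` of `G` (each list is a set of exactly `k` natural numbers) admits
an `L`-colouring: a proper colouring in which every vertex gets a colour from its list. -/
def ListColorable {V : Type*} (G : SimpleGraph V) (k : ℕ) : Prop :=
  ∀ L : V → Finset ℕ, (∀ v, (L v).card = k) → ∃ c : G.Coloring ℕ, ∀ v, c v ∈ L v

/-- The list chromatic number: the least `k` such that every `k`-list assignment `L` of `G` admits
an `L`-colouring. For finite graphs such a `k` exists, see `listColorable_card`. -/
noncomputable def listChromaticNumber {V : Type*} (G : SimpleGraph V) : ℕ :=
  sInf {k : ℕ | ListColorable G k}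

theorem listColorable_card {V : Type*} [Fintype V] (G : SimpleGraph V) :
    ListColorable G (Fintype.card V) := by
  classical
  intro L hL
  obtain ⟨f, hf, hfL⟩ := (Finset.all_card_le_biUnion_card_iff_exists_injective L).1 (by
    intro s
    rcases s.eq_empty_or_nonempty with rfl | ⟨v, hv⟩
    · simp
    · calc s.card ≤ Fintype.card V := s.card_le_univ
        _ = (L v).card := (hL v).symm
        _ ≤ _ := Finset.card_le_card (Finset.subset_biUnion_of_mem L hv))
  exact ⟨SimpleGraph.Coloring.mk f (fun hvw h => hvw.ne (hf h)), hfL⟩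

end HardCore

/-! Draw a random proper partial list colouring with weight `lam ^ (number of coloured vertices)`,
show that with positive probability it leaves every vertex a good residual list, and colour the
remaining vertices from these lists.

Fix `u` and a colour `c`, and condition on everything except which vertices of `N(u)` have colour
`c`. That colour class is then a hard-core sample on the graph spanned by the open vertices. If this
graph has at least `ℓ / 8` vertices, `c` stays unused with probability at most `1 / (8Δ⁴)`. Strong
local occupancy, applied colour by colour and summed, gives a differential inequality for the
generating function of the number of unused colours, hence a Poisson-like lower tail
(`sum_tilted_le`, `sum_few_unused_le`).

Both bounds hold against any test function `e` that ignores the colours on `N(u)`; this is the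
conditioning that the lopsided local lemma needs. Avoiding all bad events leaves residual lists of
size at least `ℓ / 2` and colour degrees at most `ℓ / 8`, and the ratio 4 is enough for
`exists_listColoring`. -/

namespace HardCore

open Finset

/-! ### The local lemma. -/

/-- A counting form of the symmetric lopsided local lemma. -/
theorem one_sub_mul_le_of_insert {V : Type*} [DecidableEq V] (P : Finset V → ℝ)
    (near : V → Finset V) (p x : ℝ) (d : ℕ) (hP : ∀ S, 0 ≤ P S)
    (hx0 : 0 ≤ x) (hx1 : x < 1)
    (hd : ∀ u, (near u).card ≤ d) (hpx : p ≤ x * (1 - x) ^ d)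
    (hins : ∀ u S, u ∉ S → P S - p * P (S \ near u) ≤ P (insert u S)) :
    ∀ S u, u ∉ S → (1 - x) * P S ≤ P (insert u S) := by
  have h1x : 0 < 1 - x := by linarith
  intro S
  induction S using Finset.strongInduction with
  | H S ih =>
    intro u hu
    -- Put the vertices of `T` back one at a time: each costs a factor `1 - x` by the induction
    -- hypothesis, since the set without it is strictly smaller than `S`.
    have key : ∀ T, T ⊆ S → (1 - x) ^ T.card * P (S \ T) ≤ P S := by
      intro T
      induction T using Finset.induction_on with
      | empty => simp
      | insert a T ha ihT =>
        intro hT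
        have haS : a ∈ S := hT (mem_insert_self a T)
        have hTS : T ⊆ S := (subset_insert a T).trans hT
        have hss : S \ insert a T ⊂ S :=
          ⟨sdiff_subset, fun h => (mem_sdiff.1 (h haS)).2 (mem_insert_self a T)⟩
        have h1 := ih _ hss a (by simp)
        have heq : insert a (S \ insert a T) = S \ T := by
          ext v
          simp only [mem_insert, mem_sdiff, not_or]
          constructor
          · rintro (rfl | ⟨h, -, h'⟩)
            · exact ⟨haS, ha⟩
            · exact ⟨h, h'⟩
          · rintro ⟨h, h'⟩
            by_cases hv : v = a
            · exact Or.inl hv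
            · exact Or.inr ⟨h, hv, h'⟩
        rw [heq] at h1
        rw [card_insert_of_notMem ha, pow_succ, mul_assoc]
        exact (mul_le_mul_of_nonneg_left h1 (by positivity)).trans (ihT hTS)
    have h2 := key (S ∩ near u) inter_subset_left
    rw [sdiff_inter_self_left] at h2
    have hcard : (S ∩ near u).card ≤ d := (card_le_card inter_subset_right).trans (hd u)
    have h3 : (1 - x) ^ d * P (S \ near u) ≤ P S := by
      refine le_trans (mul_le_mul_of_nonneg_right ?_ (hP _)) h2
      exact pow_le_pow_of_le_one h1x.le (by linarith) hcard
    have h4 : p * P (S \ near u) ≤ x * P S := by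
      calc p * P (S \ near u) ≤ x * (1 - x) ^ d * P (S \ near u) :=
            mul_le_mul_of_nonneg_right hpx (hP _)
        _ = x * ((1 - x) ^ d * P (S \ near u)) := by ring
        _ ≤ _ := mul_le_mul_of_nonneg_left h3 hx0
    linarith [hins u S hu]

theorem pos_of_insert {V : Type*} [DecidableEq V] (P : Finset V → ℝ) (a : ℝ) (ha : 0 < a)
    (h0 : 0 < P ∅) (hins : ∀ S u, u ∉ S → a * P S ≤ P (insert u S)) (S : Finset V) : 0 < P S := by
  induction S using Finset.induction_on with
  | empty => exact h0
  | insert u S hu ih => exact lt_of_lt_of_le (mul_pos ha ih) (hins S u hu)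

/-! ### List colouring with bounded colour degrees, and greedily. -/

/-- The list colourings of the vertices in `S`; the other vertices get the dummy colour `0`. -/
def listColorings {V : Type*} [Fintype V] [DecidableEq V] (G : SimpleGraph V)
    [DecidableRel G.Adj] (L : V → Finset ℕ) (S : Finset V) : Finset (V → ℕ) :=
  (Fintype.piFinset fun v => if v ∈ S then L v else {0}).filter
    fun f => ∀ v ∈ S, ∀ w ∈ S, G.Adj v w → f v ≠ f w

section
variable {V : Type*} [Fintype V] [DecidableEq V] {G : SimpleGraph V} [DecidableRel G.Adj]
  {L : V → Finset ℕ}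

theorem mem_listColorings {S : Finset V} {f : V → ℕ} : f ∈ listColorings G L S ↔
    (∀ v, f v ∈ if v ∈ S then L v else {0}) ∧ ∀ v ∈ S, ∀ w ∈ S, G.Adj v w → f v ≠ f w := by
  simp [listColorings]

theorem mem_listColorings' {S : Finset V} {f : V → ℕ} : f ∈ listColorings G L S ↔
    (∀ v ∈ S, f v ∈ L v) ∧ (∀ v ∉ S, f v = 0) ∧ ∀ v ∈ S, ∀ w ∈ S, G.Adj v w → f v ≠ f w := by
  rw [mem_listColorings, ← and_assoc]
  refine and_congr_left fun _ => ⟨fun h => ⟨fun v hv => ?_, fun v hv => ?_⟩, fun h v => ?_⟩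
  · simpa [hv] using h v
  · simpa [hv] using h v
  · by_cases hv : v ∈ S
    · simpa [hv] using h.1 v hv
    · simpa [hv] using h.2 v hv

/-- Give `v` any colour `c` on top of a colouring of `S`. If this fails, some neighbour `w` in `S`
has colour `c`; forgetting `w` loses nothing, as `c` and `w` determine what was there. -/
theorem card_mul_card_listColorings_le {S : Finset V} {v : V} (hv : v ∉ S) :
    (L v).card * (listColorings G L S).card ≤ (listColorings G L (insert v S)).card +
      ∑ c ∈ L v, ∑ w ∈ S with G.Adj v w ∧ c ∈ L w, (listColorings G L (S.erase w)).card := by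
  classical
  have hne : ∀ w ∈ S, w ≠ v := fun w hw h => hv (h ▸ hw)
  have hinj : Set.InjOn (fun x : ℕ × (V → ℕ) => Function.update x.2 v x.1)
      (L v ×ˢ listColorings G L S : Finset (ℕ × (V → ℕ))) := by
    rintro ⟨c, f⟩ h1 ⟨c', f'⟩ h2 h
    simp only [coe_product, Set.mem_prod, mem_coe, mem_listColorings'] at h1 h2
    have hc : c = c' := by simpa using congrFun h v
    refine Prod.ext hc (funext fun w => ?_)
    by_cases hw : w = v
    -- The update hides the old values at this vertex, but both are the dummy colour.
    · subst hw
      change f w = f' w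
      rw [h1.2.2.1 w hv, h2.2.2.1 w hv]
    · simpa [hw] using congrFun h w
  rw [← card_product, ← card_image_of_injOn hinj]
  have hsub : ((L v ×ˢ listColorings G L S).image fun x => Function.update x.2 v x.1) ⊆
      listColorings G L (insert v S) ∪ (L v).biUnion fun c =>
        (S.filter fun w => G.Adj v w ∧ c ∈ L w).biUnion fun w =>
          (listColorings G L (S.erase w)).image
            fun f => Function.update (Function.update f w c) v c := by
    intro g hg
    obtain ⟨⟨c, f⟩, hcf, rfl⟩ := mem_image.1 hg
    obtain ⟨hc, hf⟩ := mem_product.1 hcf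
    obtain ⟨hfL, hf0, hfp⟩ := mem_listColorings'.1 hf
    simp only at hc ⊢
    by_cases hbad : ∃ w ∈ S, G.Adj v w ∧ f w = c
    · obtain ⟨w, hwS, hvw, hfw⟩ := hbad
      refine mem_union_right _ (mem_biUnion.2 ⟨c, hc, mem_biUnion.2
        ⟨w, mem_filter.2 ⟨hwS, hvw, hfw ▸ hfL w hwS⟩, mem_image.2
          ⟨Function.update f w 0, mem_listColorings'.2 ⟨?_, ?_, ?_⟩, ?_⟩⟩⟩)
      · intro z hz
        obtain ⟨hzw, hzS⟩ := mem_erase.1 hz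
        simpa [hzw] using hfL z hzS
      · intro z hz
        by_cases hzw : z = w
        · simp [hzw]
        · simpa [hzw] using hf0 z (fun h => hz (mem_erase.2 ⟨hzw, h⟩))
      · intro z hz z' hz' hadj
        obtain ⟨hzw, hzS⟩ := mem_erase.1 hz
        obtain ⟨hzw', hzS'⟩ := mem_erase.1 hz'
        simpa [hzw, hzw'] using hfp z hzS z' hzS' hadj
      · simp [← hfw]
    · push Not at hbad
      refine mem_union_left _ (mem_listColorings'.2 ⟨?_, ?_, ?_⟩)
      · intro z hz
        by_cases hzv : z = v
        · subst hzv; simpa using hc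
        · simpa [hzv] using hfL z ((mem_insert.1 hz).resolve_left hzv)
      · intro z hz
        have hzv : z ≠ v := fun h => hz (h ▸ mem_insert_self v S)
        simpa [hzv] using hf0 z (fun h => hz (mem_insert_of_mem h))
      · intro z hz z' hz' hadj
        rcases mem_insert.1 hz with rfl | hzS <;> rcases mem_insert.1 hz' with rfl | hzS'
        · exact absurd hadj (G.irrefl)
        · simpa [hne z' hzS'] using (hbad z' hzS' hadj).symm
        · simpa [hne z hzS] using hbad z hzS hadj.symm
        · simpa [hne z hzS, hne z' hzS'] using hfp z hzS z' hzS' hadj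
  refine (card_le_card hsub).trans ((card_union_le _ _).trans (Nat.add_le_add_left ?_ _))
  refine card_biUnion_le.trans (sum_le_sum fun c _ => ?_)
  exact card_biUnion_le.trans (sum_le_sum fun w _ => card_image_le)

/-- If all lists have size at least `4 * D` and every colour of `L v` lies in the lists of at most
`D` neighbours of `v` in `S`, then `S` has a proper list colouring. -/
theorem exists_listColoring {S : Finset V} {D : ℝ} (hD : 0 < D)
    (hL : ∀ v ∈ S, 4 * D ≤ (L v).card)
    (hdeg : ∀ v ∈ S, ∀ c ∈ L v, ((S.filter fun w => G.Adj v w ∧ c ∈ L w).card : ℝ) ≤ D) :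
    ∃ f : V → ℕ, (∀ v ∈ S, f v ∈ L v) ∧ ∀ v ∈ S, ∀ w ∈ S, G.Adj v w → f v ≠ f w := by
  -- Each new vertex multiplies the count by at least `2 * D`. By induction a conflict at `w`
  -- accounts for at most `C / (2 * D)` failures, so each colour fails on at most half of the `C`
  -- colourings, and half of at least `4 * D` colours is `2 * D`.
  have key : ∀ T : Finset V, T ⊆ S → ∀ v ∈ S, v ∉ T →
      2 * D * (listColorings G L T).card ≤ ((listColorings G L (insert v T)).card : ℝ) := by
    intro T
    induction T using Finset.strongInduction with
    | H T ih =>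
      intro hTS v hvS hv
      set C : ℝ := ((listColorings G L T).card : ℝ) with hC
      have h1 : ((L v).card : ℝ) * C ≤ (listColorings G L (insert v T)).card +
          ∑ c ∈ L v, ∑ w ∈ T with G.Adj v w ∧ c ∈ L w,
            ((listColorings G L (T.erase w)).card : ℝ) := by
        rw [hC]; exact_mod_cast card_mul_card_listColorings_le (G := G) (L := L) hv
      have h2 : ∀ w ∈ T, ((listColorings G L (T.erase w)).card : ℝ) ≤ C / (2 * D) := by
        intro w hw
        have := ih _ (erase_ssubset hw) ((erase_subset _ _).trans hTS) w (hTS hw)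
          (notMem_erase w T)
        rw [insert_erase hw] at this
        rw [le_div_iff₀ (by positivity), mul_comm]
        exact this
      have h3 : ∑ c ∈ L v, ∑ w ∈ T with G.Adj v w ∧ c ∈ L w,
            ((listColorings G L (T.erase w)).card : ℝ) ≤ (L v).card * (C / 2) := by
        rw [← nsmul_eq_mul]
        refine sum_le_card_nsmul _ _ _ fun c hc => ?_
        calc _ ≤ (T.filter fun w => G.Adj v w ∧ c ∈ L w).card • (C / (2 * D)) :=
              sum_le_card_nsmul _ _ _ fun w hw => h2 w (mem_filter.1 hw).1
          _ ≤ D * (C / (2 * D)) := by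
              rw [nsmul_eq_mul]
              refine mul_le_mul_of_nonneg_right (le_trans ?_ (hdeg v hvS c hc)) (by positivity)
              exact_mod_cast card_le_card (filter_subset_filter _ hTS)
          _ = C / 2 := by field_simp
      have h4 : 4 * D * (C / 2) ≤ (L v).card * (C / 2) :=
        mul_le_mul_of_nonneg_right (hL v hvS) (by positivity)
      linarith
  have pos : ∀ T : Finset V, T ⊆ S → (0 : ℝ) < (listColorings G L T).card := by
    intro T
    induction T using Finset.induction_on with
    | empty =>
      intro _
      have : (fun _ => 0) ∈ listColorings G L ∅ := mem_listColorings'.2 (by simp)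
      exact_mod_cast card_pos.2 ⟨_, this⟩
    | insert v T hv ih =>
      intro hT
      have hTS := (subset_insert v T).trans hT
      exact lt_of_lt_of_le (mul_pos (by positivity) (ih hTS))
        (key T hTS v (hT (mem_insert_self v T)) hv)
  obtain ⟨f, hf⟩ := card_pos.1 (Nat.cast_pos.1 (pos S subset_rfl))
  obtain ⟨h1, -, h2⟩ := mem_listColorings'.1 hf
  exact ⟨f, h1, h2⟩

/-- Greedy colouring; it allows the main argument to assume lists of size at most `Δ`. -/
theorem listColorable_of_maxDegree_lt {k : ℕ} (hk : G.maxDegree < k) : ListColorable G k := by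
  intro L hL
  have key : ∀ S : Finset V, ∃ f : V → ℕ, (∀ v ∈ S, f v ∈ L v) ∧
      ∀ v ∈ S, ∀ w ∈ S, G.Adj v w → f v ≠ f w := by
    intro S
    induction S using Finset.induction_on with
    | empty => exact ⟨fun _ => 0, by simp, by simp⟩
    | insert v S hv ih =>
      obtain ⟨f, hf, hfp⟩ := ih
      have hlt : ((G.neighborFinset v).image f).card < (L v).card := by
        rw [hL]
        exact (card_image_le.trans (G.degree_le_maxDegree v)).trans_lt hk
      obtain ⟨c, hc, hcn⟩ := exists_mem_notMem_of_card_lt_card hlt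
      have hcn' : ∀ w, G.Adj v w → f w ≠ c := fun w hw h =>
        hcn (mem_image.2 ⟨w, (G.mem_neighborFinset v w).2 hw, h⟩)
      have hne : ∀ w ∈ S, w ≠ v := fun w hw h => hv (h ▸ hw)
      refine ⟨Function.update f v c, fun z hz => ?_, fun z hz z' hz' hadj => ?_⟩
      · by_cases hzv : z = v
        · subst hzv; simpa using hc
        · simpa [hzv] using hf z ((mem_insert.1 hz).resolve_left hzv)
      · rcases mem_insert.1 hz with rfl | hzS <;> rcases mem_insert.1 hz' with rfl | hzS'
        · exact absurd hadj (G.irrefl)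
        · simpa [hne z' hzS'] using (hcn' z' hadj).symm
        · simpa [hne z hzS] using hcn' z hadj.symm
        · simpa [hne z hzS, hne z' hzS'] using hfp z hzS z' hzS' hadj
  obtain ⟨f, hf, hfp⟩ := key univ
  exact ⟨SimpleGraph.Coloring.mk f fun {v w} h => hfp v (mem_univ v) w (mem_univ w) h,
    fun v => hf v (mem_univ v)⟩

end

end HardCore
-- Partial colourings and resampling of one colour.
namespace HardCore

open Finset

section
variable {V : Type*} [Fintype V] [DecidableEq V] (G : SimpleGraph V) [DecidableRel G.Adj]
  (L : V → Finset ℕ)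

/-- The proper partial list colourings of `G`; `none` marks the uncoloured vertices. -/
def partialColorings : Finset (V → Option ℕ) :=
  (Fintype.piFinset fun v => (L v).insertNone).filter
    fun σ => ∀ v w, G.Adj v w → σ v ≠ none → σ v ≠ σ w

/-- The uncoloured vertices of `N` at which the colour `c` is still available. -/
def openVertices (N : Finset V) (c : ℕ) (σ : V → Option ℕ) : Finset V :=
  N.filter fun v => σ v = none ∧ c ∈ L v ∧ ∀ w, G.Adj v w → σ w ≠ some c

/-- The independent subsets of `F`. -/
def indepSubsets (F : Finset V) : Finset (Finset V) :=
  F.powerset.filter fun I => ∀ v ∈ I, ∀ w ∈ I, ¬ G.Adj v w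

/-- The partition function of the subgraph induced by `F`. -/
def indepSum (lam : ℝ) (F : Finset V) : ℝ := ∑ I ∈ indepSubsets G F, lam ^ I.card

/-- The colours of `A` that do not appear on `N`. -/
def unusedColors (N : Finset V) (A : Finset ℕ) (σ : V → Option ℕ) : Finset ℕ :=
  A.filter fun c => ∀ v ∈ N, σ v ≠ some c

/-- The hard-core weight of a partial colouring. -/
def weight (lam : ℝ) (σ : V → Option ℕ) : ℝ := lam ^ (univ.filter fun v => σ v ≠ none).card

/-- Give the colour `c` to all vertices of `I`. -/
def paint (σ : V → Option ℕ) (c : ℕ) (I : Finset V) : V → Option ℕ :=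
  fun v => if v ∈ I then some c else σ v

/-- Remove the colour `c` from all vertices of `N`. -/
def unpaint (σ : V → Option ℕ) (c : ℕ) (N : Finset V) : V → Option ℕ :=
  fun v => if v ∈ N ∧ σ v = some c then none else σ v

variable {G L}

theorem mem_partialColorings {σ : V → Option ℕ} : σ ∈ partialColorings G L ↔
    (∀ v c, σ v = some c → c ∈ L v) ∧
      ∀ v w, G.Adj v w → ∀ c, σ v = some c → σ w ≠ some c := by
  simp only [partialColorings, mem_filter, Fintype.mem_piFinset, mem_insertNone, Option.mem_def]
  refine and_congr_right fun _ => ⟨fun h v w hvw c hc hw => ?_, fun h v w hvw hn he => ?_⟩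
  · exact h v w hvw (by simp [hc]) (hc.trans hw.symm)
  · obtain ⟨c, hc⟩ := Option.ne_none_iff_exists'.1 hn
    exact h v w hvw c hc (he ▸ hc)

theorem mem_indepSubsets {F I : Finset V} : I ∈ indepSubsets G F ↔
    I ⊆ F ∧ ∀ v ∈ I, ∀ w ∈ I, ¬ G.Adj v w := by
  simp [indepSubsets]

theorem mem_openVertices {N : Finset V} {c : ℕ} {σ : V → Option ℕ} {v : V} :
    v ∈ openVertices G L N c σ ↔
      v ∈ N ∧ σ v = none ∧ c ∈ L v ∧ ∀ w, G.Adj v w → σ w ≠ some c := by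
  simp [openVertices]

theorem openVertices_subset {N : Finset V} {c : ℕ} {σ : V → Option ℕ} :
    openVertices G L N c σ ⊆ N := filter_subset _ _

theorem weight_paint (lam : ℝ) {σ : V → Option ℕ} {c : ℕ} {I : Finset V}
    (h : ∀ v ∈ I, σ v = none) : weight lam (paint σ c I) = weight lam σ * lam ^ I.card := by
  have hd : Disjoint (univ.filter fun v => σ v ≠ none) I := by
    rw [Finset.disjoint_left]
    intro v hv hI
    exact (mem_filter.1 hv).2 (h v hI)
  rw [weight, weight, ← pow_add, ← card_union_of_disjoint hd]
  congr 2
  ext v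
  rw [mem_filter, mem_union, mem_filter]
  by_cases hv : v ∈ I <;> simp [paint, hv]

/-- Resampling the colour `c` on `N` with all other colours kept. -/
theorem sum_resample (N : Finset V) (c : ℕ) (φ : (V → Option ℕ) → ℝ) :
    ∑ σ ∈ partialColorings G L, φ σ =
      ∑ τ ∈ partialColorings G L with ∀ v ∈ N, τ v ≠ some c,
        ∑ I ∈ indepSubsets G (openVertices G L N c τ), φ (paint τ c I) := by
  -- A colouring splits uniquely into its colour class of `c` on `N` and the rest; given the rest,
  -- the class can be any independent set of open vertices.
  rw [sum_sigma']
  refine sum_bij' (fun σ _ => ⟨unpaint σ c N, N.filter fun v => σ v = some c⟩)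
    (fun x _ => paint x.1 c x.2) ?_ ?_ ?_ ?_ ?_
  · intro σ hσ
    obtain ⟨hL, hp⟩ := mem_partialColorings.1 hσ
    have hun : ∀ v a, unpaint σ c N v = some a → σ v = some a := by
      intro v a h
      by_contra hn
      simp only [unpaint] at h
      split_ifs at h
      exact hn h
    simp only [mem_sigma, mem_filter]
    refine ⟨⟨mem_partialColorings.2 ⟨fun v a h => hL v a (hun v a h), fun v w hvw a h h' =>
      hp v w hvw a (hun v a h) (hun w a h')⟩, fun v hv h => ?_⟩, mem_indepSubsets.2 ⟨?_, ?_⟩⟩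
    · have := hun v c h
      simp [unpaint, hv, this] at h
    · intro v hv
      obtain ⟨hvN, hvc⟩ := mem_filter.1 hv
      exact mem_openVertices.2 ⟨hvN, by simp [unpaint, hvN, hvc], hL v c hvc,
        fun w hw h => hp v w hw c hvc (hun w c h)⟩
    · intro v hv w hw hvw
      exact hp v w hvw c (mem_filter.1 hv).2 (mem_filter.1 hw).2
  · rintro ⟨τ, I⟩ h
    simp only [mem_sigma, mem_filter] at h
    obtain ⟨⟨hτ, hτN⟩, hI⟩ := h
    obtain ⟨hL, hp⟩ := mem_partialColorings.1 hτ
    obtain ⟨hIF, hind⟩ := mem_indepSubsets.1 hI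
    refine mem_partialColorings.2 ⟨fun v a h => ?_, fun v w hvw a h h' => ?_⟩
    · simp only [paint] at h
      split_ifs at h with hv
      · cases h
        exact (mem_openVertices.1 (hIF hv)).2.2.1
      · exact hL v a h
    · simp only [paint] at h h'
      split_ifs at h h' with hv hw hw
      · exact hind v hv w hw hvw
      · cases h
        exact (mem_openVertices.1 (hIF hv)).2.2.2 w hvw h'
      · cases h'
        exact (mem_openVertices.1 (hIF hw)).2.2.2 v hvw.symm h
      · exact hp v w hvw a h h'
  · intro σ _
    funext v
    by_cases hv : v ∈ N ∧ σ v = some c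
    · simp [paint, hv.1, hv.2]
    · have hv' : v ∉ N.filter fun v => σ v = some c := by simpa using hv
      simp only [paint, unpaint, if_neg hv', if_neg hv]
  · rintro ⟨τ, I⟩ h
    simp only [mem_sigma, mem_filter] at h
    obtain ⟨⟨hτ, hτN⟩, hI⟩ := h
    obtain ⟨hIF, hind⟩ := mem_indepSubsets.1 hI
    have hIN : ∀ v ∈ I, v ∈ N ∧ τ v = none := fun v hv =>
      ⟨(mem_openVertices.1 (hIF hv)).1, (mem_openVertices.1 (hIF hv)).2.1⟩
    have h1 : unpaint (paint τ c I) c N = τ := by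
      funext v
      by_cases hv : v ∈ I
      · simp [unpaint, paint, hv, hIN v hv]
      · by_cases hN : v ∈ N
        · simp [unpaint, paint, hv, hτN v hN]
        · simp [unpaint, paint, hv, hN]
    have h2 : (N.filter fun v => paint τ c I v = some c) = I := by
      ext v
      by_cases hv : v ∈ I
      · simp [paint, hv, hIN v hv]
      · rw [mem_filter]
        simp only [paint, hv, iff_false, not_and]
        exact hτN v
    simp only [h1, h2]
  · intro σ _
    congr 1
    funext v
    by_cases hv : v ∈ N ∧ σ v = some c
    · simp [paint, hv.1, hv.2]
    · have hv' : v ∉ N.filter fun v => σ v = some c := by simpa using hv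
      simp only [paint, unpaint, if_neg hv', if_neg hv]

/-! ### Tail bounds at one neighbourhood. -/

variable {lam : ℝ}

/-- Colour `c` is unlikely to be unused on `N` while many vertices of `N` are open for it. -/
theorem sum_unused_open_le (hlam : 0 < lam) (N : Finset V) (c : ℕ) {s M : ℝ} (hM : 0 < M)
    (hZ : ∀ F ⊆ N, s ≤ (F.card : ℝ) → M ≤ indepSum G lam F)
    (e : (V → Option ℕ) → ℝ) (he0 : ∀ σ, 0 ≤ e σ)
    (he : ∀ σ τ, (∀ v ∉ N, σ v = τ v) → e σ = e τ) :
    ∑ σ ∈ partialColorings G L with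
        (∀ v ∈ N, σ v ≠ some c) ∧ s ≤ ((openVertices G L N c σ).card : ℝ), weight lam σ * e σ ≤
      1 / M * ∑ σ ∈ partialColorings G L, weight lam σ * e σ := by
  -- Given `τ`, only `I = ∅` leaves `c` unused, so the conditional probability of this is one over
  -- the partition function of the open vertices.
  rw [sum_resample N c, mul_sum, ← filter_filter, sum_filter]
  refine sum_le_sum fun τ hτ => ?_
  have hw : 0 ≤ weight lam τ := pow_nonneg hlam.le _
  have hin : ∑ I ∈ indepSubsets G (openVertices G L N c τ),
      weight lam (paint τ c I) * e (paint τ c I) =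
        weight lam τ * e τ * indepSum G lam (openVertices G L N c τ) := by
    rw [indepSum, mul_sum]
    refine sum_congr rfl fun I hI => ?_
    have hIF := (mem_indepSubsets.1 hI).1
    rw [weight_paint lam fun v hv => (mem_openVertices.1 (hIF hv)).2.1, he (paint τ c I) τ]
    · ring
    · intro v hv
      have : v ∉ I := fun h => hv (openVertices_subset (hIF h))
      simp [paint, this]
  rw [hin]
  have hpos := mul_nonneg hw (he0 τ)
  have hZ0 : 0 ≤ indepSum G lam (openVertices G L N c τ) :=
    sum_nonneg fun I _ => pow_nonneg hlam.le _
  split_ifs with hs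
  · have := hZ _ openVertices_subset hs
    rw [one_div, inv_mul_eq_div, le_div_iff₀ hM]
    exact mul_le_mul_of_nonneg_left this hpos
  · positivity

/-- Painting uncoloured vertices affects no colour but `c`, which stays unused only if nothing is
painted. -/
theorem card_unusedColors_paint {N : Finset V} {A : Finset ℕ} {c : ℕ} (hc : c ∈ A)
    {τ : V → Option ℕ} (hτ : ∀ v ∈ N, τ v ≠ some c) {I : Finset V} (hI : I ⊆ N)
    (hIτ : ∀ v ∈ I, τ v = none) :
    (unusedColors N A (paint τ c I)).card =
      ((unusedColors N A τ).erase c).card + if I = ∅ then 1 else 0 := by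
  have hpaint : ∀ a, a ≠ c → ((∀ v ∈ N, paint τ c I v ≠ some a) ↔ ∀ v ∈ N, τ v ≠ some a) := by
    intro a ha
    refine forall₂_congr fun v hv => ?_
    by_cases hvI : v ∈ I
    · simp [paint, hvI, hIτ v hvI, ha.symm]
    · simp [paint, hvI]
  split_ifs with h
  · subst h
    have : paint τ c ∅ = τ := by funext v; simp [paint]
    rw [this, card_erase_add_one]
    exact mem_filter.2 ⟨hc, hτ⟩
  · congr 1
    ext a
    by_cases ha : a = c
    · subst ha
      obtain ⟨v, hv⟩ := nonempty_iff_ne_empty.2 h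
      simp only [unusedColors, mem_filter, mem_erase, ne_eq, not_true_eq_false, false_and,
        iff_false, not_and, not_forall, not_not]
      exact fun _ => ⟨v, hI hv, by simp [paint, hv]⟩
    · simp [unusedColors, ha, hpaint a ha]

/-- Condition on all but the class `I` of `c` on `N`, and let `m` count the other unused colours.
Both powers of `y` on the right become `y ^ m`: where the indicator is nonzero, `c` is itself
counted, whence the exponent minus one; where `I` is nonempty, it is not. What remains is the
occupancy inequality on the open vertices. -/
theorem sum_tilted_le_of_color (hlam : 0 < lam) (N : Finset V) (A : Finset ℕ) {c : ℕ}
    (hc : c ∈ A) {b γ : ℝ}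
    (hocc : ∀ F ⊆ N, indepSum G lam F ≤
      b + γ * ∑ I ∈ indepSubsets G F, (I.card : ℝ) * lam ^ I.card)
    (e : (V → Option ℕ) → ℝ) (he0 : ∀ σ, 0 ≤ e σ)
    (he : ∀ σ τ, (∀ v ∉ N, σ v = τ v) → e σ = e τ) {y : ℝ} (hy0 : 0 ≤ y) (hy1 : y ≤ 1) :
    ∑ σ ∈ partialColorings G L, weight lam σ * e σ * y ^ (unusedColors N A σ).card ≤
      ∑ σ ∈ partialColorings G L, weight lam σ * e σ *
        (b * ((if ∀ v ∈ N, σ v ≠ some c then 1 else 0) * y ^ ((unusedColors N A σ).card - 1)) +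
          γ * (((N.filter fun v => σ v = some c).card : ℝ) * y ^ (unusedColors N A σ).card)) := by
  rw [sum_resample N c, sum_resample N c]
  refine sum_le_sum fun τ hτ => ?_
  obtain ⟨hτΩ, hτN⟩ := mem_filter.1 hτ
  set F := openVertices G L N c τ with hF
  set m := ((unusedColors N A τ).erase c).card with hm
  have hpos : 0 ≤ weight lam τ * e τ := mul_nonneg (pow_nonneg hlam.le _) (he0 τ)
  have hfacts : ∀ I ∈ indepSubsets G F, weight lam (paint τ c I) * e (paint τ c I) =
      weight lam τ * e τ * lam ^ I.card ∧
      (unusedColors N A (paint τ c I)).card = m + (if I = ∅ then 1 else 0) ∧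
      (N.filter fun v => paint τ c I v = some c) = I := by
    intro I hI
    have hIF := (mem_indepSubsets.1 hI).1
    have hIN : I ⊆ N := hIF.trans openVertices_subset
    have hIτ : ∀ v ∈ I, τ v = none := fun v hv => (mem_openVertices.1 (hIF hv)).2.1
    refine ⟨?_, card_unusedColors_paint hc hτN hIN hIτ, ?_⟩
    · rw [weight_paint lam hIτ, he (paint τ c I) τ]
      · ring
      · intro v hv
        have : v ∉ I := fun h => hv (hIN h)
        simp [paint, this]
    · ext v
      by_cases hv : v ∈ I
      · simp [paint, hv, hIN hv]
      · rw [mem_filter]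
        simp only [paint, hv, iff_false, not_and]
        exact hτN v
  have hunused : ∀ I ∈ indepSubsets G F,
      (∀ v ∈ N, paint τ c I v ≠ some c) ↔ I = ∅ := by
    intro I hI
    rw [← (hfacts I hI).2.2, filter_eq_empty_iff, (hfacts I hI).2.2]
  have hleft : ∑ I ∈ indepSubsets G F, weight lam (paint τ c I) * e (paint τ c I) *
      y ^ (unusedColors N A (paint τ c I)).card ≤ weight lam τ * e τ * y ^ m * indepSum G lam F := by
    rw [indepSum, mul_sum]
    refine sum_le_sum fun I hI => ?_
    obtain ⟨h1, h2, -⟩ := hfacts I hI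
    rw [h1, h2]
    have : y ^ (m + if I = ∅ then 1 else 0) ≤ y ^ m :=
      pow_le_pow_of_le_one hy0 hy1 (Nat.le_add_right _ _)
    calc _ ≤ weight lam τ * e τ * lam ^ I.card * y ^ m :=
          mul_le_mul_of_nonneg_left this (mul_nonneg hpos (pow_nonneg hlam.le _))
      _ = _ := by ring
  have hempty : ∅ ∈ indepSubsets G F := mem_indepSubsets.2 (by simp)
  have hright : ∑ I ∈ indepSubsets G F, weight lam (paint τ c I) * e (paint τ c I) *
      (b * ((if ∀ v ∈ N, paint τ c I v ≠ some c then 1 else 0) *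
          y ^ ((unusedColors N A (paint τ c I)).card - 1)) +
        γ * (((N.filter fun v => paint τ c I v = some c).card : ℝ) *
          y ^ (unusedColors N A (paint τ c I)).card)) =
      weight lam τ * e τ * y ^ m *
        (b + γ * ∑ I ∈ indepSubsets G F, (I.card : ℝ) * lam ^ I.card) := by
    have hb : b = ∑ I ∈ indepSubsets G F, if I = ∅ then b else 0 := by
      rw [sum_ite_eq' (indepSubsets G F) ∅ (fun _ => b), if_pos hempty]
    conv_rhs => rw [hb]
    rw [mul_sum _ _ γ, ← sum_add_distrib, mul_sum]
    refine sum_congr rfl fun I hI => ?_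
    obtain ⟨h1, h2, h3⟩ := hfacts I hI
    rw [h1, h2, h3, if_congr (hunused I hI) rfl rfl]
    split_ifs with h
    · subst h; simp; ring
    · simp; ring
  rw [hright]
  exact hleft.trans (mul_le_mul_of_nonneg_left (hocc F openVertices_subset) (by positivity))

/-- Sum over the colours of `A`: the indicators add up to the number of unused colours, which makes
the right side a derivative in `y`, and the colour classes on `N` are disjoint, so their sizes total
at most `N.card`. -/
theorem sum_tilted_le (hlam : 0 < lam) (N : Finset V) (A : Finset ℕ) {b γ : ℝ} (hγ : 0 ≤ γ)
    (hocc : ∀ F ⊆ N, indepSum G lam F ≤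
      b + γ * ∑ I ∈ indepSubsets G F, (I.card : ℝ) * lam ^ I.card)
    (e : (V → Option ℕ) → ℝ) (he0 : ∀ σ, 0 ≤ e σ)
    (he : ∀ σ τ, (∀ v ∉ N, σ v = τ v) → e σ = e τ) {y : ℝ} (hy0 : 0 ≤ y) (hy1 : y ≤ 1) :
    (A.card - γ * N.card) *
      ∑ σ ∈ partialColorings G L, weight lam σ * e σ * y ^ (unusedColors N A σ).card ≤
    b * ∑ σ ∈ partialColorings G L, weight lam σ * e σ *
      ((unusedColors N A σ).card * y ^ ((unusedColors N A σ).card - 1)) := by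
  have h1 := sum_le_sum fun c (hc : c ∈ A) =>
    sum_tilted_le_of_color (L := L) hlam N A hc hocc e he0 he hy0 hy1
  rw [sum_const, nsmul_eq_mul, sum_comm] at h1
  rw [sub_mul, sub_le_iff_le_add, mul_sum _ _ b, mul_sum _ _ (γ * (N.card : ℝ)), ← sum_add_distrib]
  refine h1.trans (sum_le_sum fun σ _ => ?_)
  have hpos : 0 ≤ weight lam σ * e σ := mul_nonneg (pow_nonneg hlam.le _) (he0 σ)
  rw [← mul_sum, sum_add_distrib, ← mul_sum, ← mul_sum, ← sum_mul, ← sum_mul, sum_boole]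
  have hcol : ∑ c ∈ A, ((N.filter fun v => σ v = some c).card : ℝ) ≤ N.card := by
    rw [← Nat.cast_sum]
    have hdis : (A : Set ℕ).PairwiseDisjoint fun c => N.filter fun v => σ v = some c := by
      intro c _ c' _ hcc
      rw [Function.onFun, Finset.disjoint_left]
      intro v hv hv'
      exact hcc (Option.some_injective _
        ((mem_filter.1 hv).2.symm.trans (mem_filter.1 hv').2))
    rw [← card_biUnion hdis]
    exact_mod_cast card_le_card (biUnion_subset.2 fun c _ => filter_subset _ _)
  have h2 := mul_le_mul_of_nonneg_right hcol (pow_nonneg hy0 (unusedColors N A σ).card)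
  have h3 := mul_le_mul_of_nonneg_left h2 hγ
  have h4 := mul_le_mul_of_nonneg_left h3 hpos
  change _ * (b * (((unusedColors N A σ).card : ℝ) * _) + _) ≤ _
  linarith

/-- An exponential moment bound for the number of unused colours. -/
theorem sum_tilted_le_exp (hlam : 0 < lam) (N : Finset V) (A : Finset ℕ) {b γ : ℝ} (hb : 0 < b)
    (hγ : 0 ≤ γ)
    (hocc : ∀ F ⊆ N, indepSum G lam F ≤
      b + γ * ∑ I ∈ indepSubsets G F, (I.card : ℝ) * lam ^ I.card)
    (e : (V → Option ℕ) → ℝ) (he0 : ∀ σ, 0 ≤ e σ)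
    (he : ∀ σ τ, (∀ v ∉ N, σ v = τ v) → e σ = e τ) {y : ℝ} (hy0 : 0 ≤ y) (hy1 : y ≤ 1) :
    ∑ σ ∈ partialColorings G L, weight lam σ * e σ * y ^ (unusedColors N A σ).card ≤
      Real.exp (-((A.card - γ * N.card) / b * (1 - y))) *
        ∑ σ ∈ partialColorings G L, weight lam σ * e σ := by
  set μ : ℝ := (A.card - γ * N.card) / b with hμ
  set W : ℝ → ℝ := fun z =>
    ∑ σ ∈ partialColorings G L, weight lam σ * e σ * z ^ (unusedColors N A σ).card with hW
  set W' : ℝ → ℝ := fun z => ∑ σ ∈ partialColorings G L, weight lam σ * e σ *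
      ((unusedColors N A σ).card * z ^ ((unusedColors N A σ).card - 1)) with hW'
  have hder : ∀ z, HasDerivAt W (W' z) z := by
    intro z
    refine HasDerivAt.fun_sum fun σ _ => ?_
    exact (hasDerivAt_pow _ z).const_mul _
  have hder2 : ∀ z, HasDerivAt (fun z => W z * Real.exp (-(μ * z)))
      (W' z * Real.exp (-(μ * z)) + W z * (Real.exp (-(μ * z)) * (-μ))) z := by
    intro z
    refine (hder z).mul ?_
    have := ((hasDerivAt_id z).const_mul μ).neg.exp
    simpa using this
  -- The inequality `μ * W ≤ W'` integrates to a comparison with the generating function of a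
  -- Poisson variable of mean `μ`.
  have hmono : MonotoneOn (fun z => W z * Real.exp (-(μ * z))) (Set.Icc 0 1) := by
    refine monotoneOn_of_deriv_nonneg (convex_Icc 0 1)
      (fun z _ => (hder2 z).continuousAt.continuousWithinAt)
      (fun z _ => (hder2 z).differentiableAt.differentiableWithinAt) fun z hz => ?_
    rw [(hder2 z).deriv]
    rw [interior_Icc] at hz
    have h := sum_tilted_le (L := L) hlam N A hγ hocc e he0 he hz.1.le hz.2.le
    have h' : μ * W z ≤ W' z := by
      rw [hμ, div_mul_eq_mul_div, div_le_iff₀ hb, mul_comm (W' z)]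
      exact h
    have := mul_le_mul_of_nonneg_right h' (Real.exp_pos (-(μ * z))).le
    linarith
  have hfin := hmono ⟨hy0, hy1⟩ ⟨zero_le_one, le_rfl⟩ hy1
  have hW1 : W 1 = ∑ σ ∈ partialColorings G L, weight lam σ * e σ := by simp [hW]
  simp only at hfin
  rw [hW1] at hfin
  calc W y = W y * Real.exp (-(μ * y)) * Real.exp (μ * y) := by
        rw [mul_assoc, ← Real.exp_add]; simp
    _ ≤ (∑ σ ∈ partialColorings G L, weight lam σ * e σ) * Real.exp (-(μ * 1)) *
          Real.exp (μ * y) := mul_le_mul_of_nonneg_right hfin (Real.exp_pos _).le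
    _ = _ := by rw [mul_assoc, ← Real.exp_add, mul_comm]; congr 2; ring

/-- A lower tail bound for the number of unused colours. -/
theorem sum_few_unused_le (hlam : 0 < lam) (N : Finset V) (A : Finset ℕ) {b γ : ℝ} (hb : 0 < b)
    (hγ : 0 ≤ γ)
    (hocc : ∀ F ⊆ N, indepSum G lam F ≤
      b + γ * ∑ I ∈ indepSubsets G F, (I.card : ℝ) * lam ^ I.card)
    (e : (V → Option ℕ) → ℝ) (he0 : ∀ σ, 0 ≤ e σ)
    (he : ∀ σ τ, (∀ v ∉ N, σ v = τ v) → e σ = e τ) {y a : ℝ} (hy0 : 0 < y) (hy1 : y ≤ 1) :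
    ∑ σ ∈ partialColorings G L with ((unusedColors N A σ).card : ℝ) < a, weight lam σ * e σ ≤
      Real.exp (-Real.log y * a - (A.card - γ * N.card) / b * (1 - y)) *
        ∑ σ ∈ partialColorings G L, weight lam σ * e σ := by
  have h := sum_tilted_le_exp (L := L) hlam N A hb hγ hocc e he0 he hy0.le hy1
  rw [sub_eq_add_neg, Real.exp_add, mul_assoc]
  refine le_trans ?_ (mul_le_mul_of_nonneg_left h (Real.exp_pos _).le)
  rw [mul_sum, sum_filter]
  refine sum_le_sum fun σ _ => ?_
  have hpos : 0 ≤ weight lam σ * e σ := mul_nonneg (pow_nonneg hlam.le _) (he0 σ)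
  split_ifs with hX
  · have hlog : Real.log y ≤ 0 := Real.log_nonpos hy0.le hy1
    -- Chernoff: with fewer than `a` unused colours, `y` to the power of their number minus `a` is
    -- at least 1, as `y ≤ 1`.
    have : 1 ≤ Real.exp (-Real.log y * a) * y ^ (unusedColors N A σ).card := by
      rw [← Real.exp_log (pow_pos hy0 (unusedColors N A σ).card), Real.log_pow, ← Real.exp_add,
        Real.one_le_exp_iff]
      nlinarith
    calc weight lam σ * e σ = weight lam σ * e σ * 1 := (mul_one _).symm
      _ ≤ _ := mul_le_mul_of_nonneg_left this hpos
      _ = _ := by ring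
  · positivity

end

end HardCore
-- The hypotheses, restated for sets of neighbours.
namespace HardCore

open Finset

section
variable {V : Type*} [Fintype V] [DecidableEq V] {G : SimpleGraph V} [DecidableRel G.Adj]
  {L : V → Finset ℕ} {lam : ℝ}

theorem one_le_indepSum (hlam : 0 < lam) (F : Finset V) : 1 ≤ indepSum G lam F := by
  have h : ∅ ∈ indepSubsets G F := mem_indepSubsets.2 (by simp)
  have := single_le_sum (f := fun I : Finset V => lam ^ I.card)
    (fun I _ => pow_nonneg hlam.le _) h
  simpa [indepSum] using this

theorem hasDerivAt_indepSum (F : Finset V) (lam : ℝ) :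
    HasDerivAt (fun z => indepSum G z F)
      (∑ I ∈ indepSubsets G F, (I.card : ℝ) * lam ^ (I.card - 1)) lam :=
  HasDerivAt.fun_sum fun _ _ => hasDerivAt_pow _ lam

theorem mul_deriv_indepSum (F : Finset V) (lam : ℝ) :
    lam * deriv (fun z => indepSum G z F) lam =
      ∑ I ∈ indepSubsets G F, (I.card : ℝ) * lam ^ I.card := by
  rw [(hasDerivAt_indepSum F lam).deriv, mul_sum]
  refine sum_congr rfl fun I _ => ?_
  rcases Nat.eq_zero_or_pos I.card with h | h
  · simp [h]
  · rw [mul_left_comm, mul_pow_sub_one h.ne']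

open Classical in
theorem partitionFunction_eq_indepSum {W : Type*} [Fintype W] {H : SimpleGraph W} (ι : W ↪ V)
    {F : Finset V} (hadj : ∀ x y, H.Adj x y ↔ G.Adj (ι x) (ι y))
    (hF : ∀ v, v ∈ F ↔ ∃ x, ι x = v) : partitionFunction H = fun z => indepSum G z F := by
  funext z
  refine sum_bij' (fun I _ => I.map ι) (fun J _ => univ.filter fun x => ι x ∈ J) ?_ ?_ ?_ ?_ ?_
  · intro I hI
    rw [mem_filter] at hI
    refine mem_indepSubsets.2 ⟨fun v hv => ?_, fun v hv w hw hvw => ?_⟩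
    · obtain ⟨x, -, rfl⟩ := mem_map.1 hv
      exact (hF _).2 ⟨x, rfl⟩
    · obtain ⟨x, hx, rfl⟩ := mem_map.1 hv
      obtain ⟨y, hy, rfl⟩ := mem_map.1 hw
      exact hI.2 hx hy (fun h => G.irrefl (h ▸ hvw)) ((hadj x y).2 hvw)
  · intro J hJ
    obtain ⟨-, hJ'⟩ := mem_indepSubsets.1 hJ
    rw [mem_filter]
    refine ⟨mem_univ _, fun x hx y hy _ hxy => ?_⟩
    exact hJ' _ (mem_filter.1 hx).2 _ (mem_filter.1 hy).2 ((hadj x y).1 hxy)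
  · intro I _
    ext x
    simp
  · intro J hJ
    obtain ⟨hJF, -⟩ := mem_indepSubsets.1 hJ
    ext v
    simp only [mem_map, mem_filter, mem_univ, true_and]
    constructor
    · rintro ⟨x, hx, rfl⟩
      exact hx
    · intro hv
      obtain ⟨x, rfl⟩ := (hF v).1 (hJF hv)
      exact ⟨x, hv, rfl⟩
  · intro I _
    rw [card_map]

/-- Every set of neighbours of `u` spans a subgraph of the neighbourhood of `u`. -/
theorem exists_subgraph_partitionFunction_eq (u : V) {F : Finset V}
    (hF : F ⊆ G.neighborFinset u) :
    ∃ S : (G.induce (G.neighborSet u)).Subgraph, ∀ _ : Fintype S.verts,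
      Fintype.card S.verts = F.card ∧ partitionFunction S.coe = fun z => indepSum G z F := by
  obtain ⟨S, hS, hSadj⟩ : ∃ S : (G.induce (G.neighborSet u)).Subgraph,
      (∀ x, x ∈ S.verts ↔ x.1 ∈ F) ∧
        ∀ x y, S.Adj x y ↔ x.1 ∈ F ∧ y.1 ∈ F ∧ G.Adj x.1 y.1 :=
    ⟨(⊤ : (G.induce (G.neighborSet u)).Subgraph).induce {x | x.1 ∈ F}, by simp, by simp⟩
  refine ⟨S, fun _ => ?_⟩
  let ι : S.verts ↪ V := ⟨fun x => x.1.1, fun x y h => Subtype.ext (Subtype.ext h)⟩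
  have hι : ∀ v, v ∈ F ↔ ∃ x, ι x = v := fun v =>
    ⟨fun hv => ⟨⟨⟨v, (G.mem_neighborFinset u v).1 (hF hv)⟩, (hS _).2 hv⟩, rfl⟩,
      fun ⟨x, hx⟩ => hx ▸ (hS _).1 x.2⟩
  refine ⟨?_, partitionFunction_eq_indepSum ι (fun x y => ?_) hι⟩
  · rw [Fintype.card, ← card_map ι]
    congr 1
    ext v
    rw [hι]
    simp only [mem_map, mem_univ, true_and]
  · rw [SimpleGraph.Subgraph.coe_adj, hSadj]
    exact ⟨fun h => h.2.2, fun h => ⟨(hS _).1 x.2, (hS _).1 y.2, h⟩⟩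

theorem indepSum_le_of_strongLocalOccupancy {β γ : ℝ} (hlam : 0 < lam)
    (hocc : StrongLocalOccupancy G lam β γ) (u : V) {F : Finset V}
    (hF : F ⊆ G.neighborFinset u) :
    indepSum G lam F ≤ β * (lam / (1 + lam)) +
      γ * ∑ I ∈ indepSubsets G F, (I.card : ℝ) * lam ^ I.card := by
  obtain ⟨S, hS⟩ := exists_subgraph_partitionFunction_eq u hF
  have h := hocc u S
  rw [(hS _).2] at h
  have hpos : 0 < indepSum G lam F := zero_lt_one.trans_le (one_le_indepSum hlam F)
  simp only [mul_deriv_indepSum] at h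
  have h2 := mul_le_mul_of_nonneg_right h hpos.le
  rw [one_mul] at h2
  refine h2.trans_eq ?_
  field_simp

theorem le_indepSum_of_neighborhoodPartitionBound {s M : ℝ}
    (hZ : NeighborhoodPartitionBound G lam s M) (u : V) {F : Finset V}
    (hF : F ⊆ G.neighborFinset u) (hs : s ≤ (F.card : ℝ)) : M ≤ indepSum G lam F := by
  obtain ⟨S, hS⟩ := exists_subgraph_partitionFunction_eq u hF
  have h := hZ u S
  rw [(hS _).2, (hS _).1] at h
  exact h hs

/-! ### Deficient vertices and their dependencies. -/

variable (G) in
/-- The vertices reached from `u` by walks of length two or three. -/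
def walkNeighbors (u : V) : Finset V :=
  (G.neighborFinset u).biUnion fun v =>
    G.neighborFinset v ∪ (G.neighborFinset v).biUnion fun w => G.neighborFinset w

theorem card_walkNeighbors_le {Δ : ℕ} (hΔ : ∀ v, G.degree v ≤ Δ) (u : V) :
    (walkNeighbors G u).card ≤ Δ * (Δ + Δ * Δ) := by
  have hb : ∀ (f : V → Finset V) (v : V) (m : ℕ), (∀ w, (f w).card ≤ m) →
      ((G.neighborFinset v).biUnion f).card ≤ Δ * m := fun f v m hf =>
    (card_biUnion_le_card_mul _ _ m fun w _ => hf w).trans (Nat.mul_le_mul_right _ (hΔ v))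
  refine hb _ _ _ fun v => (card_union_le _ _).trans (Nat.add_le_add (hΔ v) ?_)
  exact hb _ _ _ fun w => hΔ w

variable (G L) in
/-- A vertex is deficient if few of its colours are unused on its neighbourhood, or if an unused
one is open at many neighbours. -/
def Deficient (a s : ℝ) (u : V) (σ : V → Option ℕ) : Prop :=
  ((unusedColors (G.neighborFinset u) (L u) σ).card : ℝ) < a ∨
    ∃ c ∈ L u, (∀ v ∈ G.neighborFinset u, σ v ≠ some c) ∧
      s ≤ ((openVertices G L (G.neighborFinset u) c σ).card : ℝ)

/-- Deficiency at `w` reads only the colours at the ends of walks of length one or two from `w`.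
Such an end lies in `N(u)` only if a walk of length two or three joins `u` to `w`. -/
theorem deficient_congr {a s : ℝ} {u w : V} (hw : w ∉ walkNeighbors G u) {σ τ : V → Option ℕ}
    (h : ∀ v ∉ G.neighborFinset u, σ v = τ v) :
    Deficient G L a s w σ ↔ Deficient G L a s w τ := by
  have h1 : ∀ v ∈ G.neighborFinset w, σ v = τ v := by
    refine fun v hv => h v fun hvu => hw (mem_biUnion.2 ⟨v, hvu, mem_union_left _ ?_⟩)
    rw [SimpleGraph.mem_neighborFinset] at hv ⊢
    exact hv.symm
  have h2 : ∀ v ∈ G.neighborFinset w, ∀ z, G.Adj v z → σ z = τ z := by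
    refine fun v hv z hz => h z fun hzu => hw (mem_biUnion.2 ⟨z, hzu, mem_union_right _
      (mem_biUnion.2 ⟨v, (G.mem_neighborFinset z v).2 hz.symm, ?_⟩)⟩)
    rw [SimpleGraph.mem_neighborFinset] at hv ⊢
    exact hv.symm
  have h3 : ∀ c, (∀ v ∈ G.neighborFinset w, σ v ≠ some c) ↔
      ∀ v ∈ G.neighborFinset w, τ v ≠ some c := fun c =>
    forall₂_congr fun v hv => by rw [h1 v hv]
  have h4 : unusedColors (G.neighborFinset w) (L w) σ =
      unusedColors (G.neighborFinset w) (L w) τ := filter_congr fun c _ => h3 c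
  have h5 : ∀ c, openVertices G L (G.neighborFinset w) c σ =
      openVertices G L (G.neighborFinset w) c τ := by
    refine fun c => filter_congr fun v hv => ?_
    rw [h1 v hv]
    exact and_congr_right fun _ => and_congr_right fun _ =>
      forall₂_congr fun z hz => by rw [h2 v hv z hz]
  simp only [Deficient, h3, h4, h5]

-- A union bound over the two kinds of deficiency and, for the second, over the colours of `L u`.
open Classical in
theorem sum_deficient_le (hlam : 0 < lam) (u : V) {a s M p : ℝ} (hM : 0 < M)
    (hZ : ∀ F ⊆ G.neighborFinset u, s ≤ (F.card : ℝ) → M ≤ indepSum G lam F)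
    (e : (V → Option ℕ) → ℝ) (he0 : ∀ σ, 0 ≤ e σ)
    (he : ∀ σ τ, (∀ v ∉ G.neighborFinset u, σ v = τ v) → e σ = e τ)
    (hfew : ∑ σ ∈ partialColorings G L with
        ((unusedColors (G.neighborFinset u) (L u) σ).card : ℝ) < a, weight lam σ * e σ ≤
      p * ∑ σ ∈ partialColorings G L, weight lam σ * e σ) :
    ∑ σ ∈ partialColorings G L with Deficient G L a s u σ, weight lam σ * e σ ≤
      (p + (L u).card / M) * ∑ σ ∈ partialColorings G L, weight lam σ * e σ := by
  have hpos : ∀ σ, 0 ≤ weight lam σ * e σ := fun σ =>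
    mul_nonneg (pow_nonneg hlam.le _) (he0 σ)
  have hopen := sum_le_sum fun c (_ : c ∈ L u) =>
    sum_unused_open_le (L := L) hlam (G.neighborFinset u) c hM hZ e he0 he
  rw [sum_const, nsmul_eq_mul, ← mul_assoc, mul_one_div] at hopen
  rw [add_mul]
  refine le_trans ?_ (add_le_add hfew hopen)
  simp only [sum_filter]
  rw [sum_comm, ← sum_add_distrib]
  refine sum_le_sum fun σ _ => ?_
  have hnn : ∀ c ∈ L u, 0 ≤ if (∀ v ∈ G.neighborFinset u, σ v ≠ some c) ∧
      s ≤ ((openVertices G L (G.neighborFinset u) c σ).card : ℝ)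
        then weight lam σ * e σ else 0 := by
    intro c _
    split_ifs
    · exact hpos σ
    · exact le_rfl
  split_ifs with hD hX hX
  · exact le_add_of_nonneg_right (sum_nonneg hnn)
  · obtain ⟨c, hc, hcs⟩ := hD.resolve_left hX
    rw [zero_add]
    refine le_trans ?_ (single_le_sum hnn hc)
    rw [if_pos hcs]
  · exact absurd (Or.inl hX) hD
  · exact add_nonneg le_rfl (sum_nonneg hnn)

open Classical in
theorem exists_partialColoring_not_deficient (hlam : 0 < lam) {a s p x : ℝ} {d : ℕ}
    (hx0 : 0 ≤ x) (hx1 : x < 1) (hpx : p ≤ x * (1 - x) ^ d)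
    (hd : ∀ u, (walkNeighbors G u).card ≤ d)
    (hdef : ∀ (u : V) (e : (V → Option ℕ) → ℝ), (∀ σ, 0 ≤ e σ) →
      (∀ σ τ, (∀ v ∉ G.neighborFinset u, σ v = τ v) → e σ = e τ) →
      ∑ σ ∈ partialColorings G L with Deficient G L a s u σ, weight lam σ * e σ ≤
        p * ∑ σ ∈ partialColorings G L, weight lam σ * e σ) :
    ∃ σ ∈ partialColorings G L, ∀ u, ¬ Deficient G L a s u σ := by
  set P : Finset V → ℝ := fun S =>
    ∑ σ ∈ partialColorings G L with ∀ w ∈ S, ¬ Deficient G L a s w σ, weight lam σ with hP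
  have hw : ∀ σ : V → Option ℕ, 0 ≤ weight lam σ := fun σ => pow_nonneg hlam.le _
  have hP0 : 0 < P ∅ := by
    refine sum_pos (fun σ _ => pow_pos hlam _) ⟨fun _ => none, ?_⟩
    simp [mem_partialColorings]
  have hins : ∀ u S, u ∉ S → P S - p * P (S \ walkNeighbors G u) ≤ P (insert u S) := by
    intro u S _
    -- The test function is the indicator that no vertex of `S` far from `u` is deficient; it
    -- ignores the colours on `N(u)`.
    have h := hdef u
      (fun σ => if ∀ w ∈ S \ walkNeighbors G u, ¬ Deficient G L a s w σ then 1 else 0)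
      (fun σ => by split_ifs <;> simp) (fun σ τ h => if_congr
        (forall₂_congr fun w hw => not_congr (deficient_congr (mem_sdiff.1 hw).2 h)) rfl rfl)
    simp only [mul_ite, mul_one, mul_zero, ← sum_filter, filter_filter] at h
    have h' : P S - P (insert u S) ≤ ∑ σ ∈ partialColorings G L with
        Deficient G L a s u σ ∧ ∀ w ∈ S \ walkNeighbors G u, ¬ Deficient G L a s w σ,
          weight lam σ := by
      simp only [hP, sum_filter]
      rw [← sum_sub_distrib]
      refine sum_le_sum fun σ _ => ?_
      by_cases hu : Deficient G L a s u σ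
      · by_cases hS : ∀ w ∈ S, ¬ Deficient G L a s w σ
        · have hS' : ∀ w ∈ S \ walkNeighbors G u, ¬ Deficient G L a s w σ :=
            fun w hw => hS w (mem_sdiff.1 hw).1
          rw [if_pos hS, if_neg (fun h => h u (mem_insert_self _ _) hu), if_pos ⟨hu, hS'⟩, sub_zero]
        · rw [if_neg hS, if_neg (fun h => h u (mem_insert_self _ _) hu), sub_zero]
          split_ifs
          · exact hw σ
          · exact le_rfl
      · rw [if_neg (fun h : _ ∧ _ => hu h.1), sub_nonpos]
        exact (if_congr (by simp [hu]) rfl rfl).le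
    linarith
  have hstep := one_sub_mul_le_of_insert P (walkNeighbors G) p x d
    (fun S => sum_nonneg fun σ _ => hw σ) hx0 hx1 hd hpx hins
  have hpos := pos_of_insert P (1 - x) (by linarith) hP0 hstep univ
  obtain ⟨σ, hσ, -⟩ := exists_ne_zero_of_sum_ne_zero hpos.ne'
  obtain ⟨hσΩ, hσ'⟩ := mem_filter.1 hσ
  exact ⟨σ, hσΩ, fun u => hσ' u (mem_univ u)⟩

/-- The residual list of an uncoloured vertex consists of the colours unused around it. An
uncoloured neighbour whose residual list contains `c` is open for `c`, so the two halves of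
non-deficiency bound list sizes and colour degrees. -/
theorem exists_coloring_of_not_deficient {s : ℝ} (hs : 0 < s) {σ : V → Option ℕ}
    (hσ : σ ∈ partialColorings G L) (hdef : ∀ u, ¬ Deficient G L (4 * s) s u σ) :
    ∃ c : G.Coloring ℕ, ∀ v, c v ∈ L v := by
  obtain ⟨hσL, hσp⟩ := mem_partialColorings.1 hσ
  obtain ⟨f, hfL, hfp⟩ := exists_listColoring (G := G) (S := univ.filter fun v => σ v = none)
    (L := fun v => unusedColors (G.neighborFinset v) (L v) σ) hs
    (fun v _ => not_lt.1 fun h => hdef v (Or.inl h)) (by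
      intro v _ c hc
      obtain ⟨hcL, hcu⟩ := mem_filter.1 hc
      refine (le_trans ?_ (not_le.1 fun h => hdef v (Or.inr ⟨c, hcL, hcu, h⟩)).le)
      refine Nat.cast_le.2 (card_le_card fun w hw => ?_)
      simp only [mem_filter, mem_univ, true_and, unusedColors,
        SimpleGraph.mem_neighborFinset] at hw
      exact mem_openVertices.2 ⟨(G.mem_neighborFinset v w).2 hw.2.1, hw.1, hw.2.2⟩)
  simp only [mem_filter, mem_univ, true_and] at hfL hfp
  have hfL' : ∀ v, σ v = none → f v ∈ L v ∧ ∀ w, G.Adj v w → σ w ≠ some (f v) := fun v hv => by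
    obtain ⟨h1, h2⟩ := mem_filter.1 (hfL v hv)
    exact ⟨h1, fun w hw => h2 w ((G.mem_neighborFinset v w).2 hw)⟩
  refine ⟨SimpleGraph.Coloring.mk (fun v => (σ v).getD (f v)) ?_, ?_⟩
  · intro v w hvw
    rcases hv : σ v with _ | c <;> rcases hw : σ w with _ | c'
    · simpa using hfp v hv w hw hvw
    · have := (hfL' v hv).2 w hvw
      rw [hw] at this
      simpa [eq_comm] using this
    · have := (hfL' w hw).2 v hvw.symm
      rw [hv] at this
      simpa using this
    · have := hσp v w hvw c hv
      rw [hw] at this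
      simpa [eq_comm] using this
  · intro v
    change (σ v).getD (f v) ∈ L v
    rcases hv : σ v with _ | c
    · exact (hfL' v hv).1
    · exact hσL v c hv

end

/-! ### Numerical estimates and the conclusion. -/

theorem exp_tail_le {Δ ℓ δ μ : ℝ} (hΔ : 64 ≤ Δ) (hℓ : 0 < ℓ) (hδ0 : 0 < δ) (hδ1 : δ < 1)
    (hδ : δ ^ 2 * ℓ = 7 * Real.log Δ) (hμ : ℓ / (1 - δ) - 1 ≤ μ) :
    Real.exp (-Real.log (1 - δ) * (ℓ / 2) - μ * (1 - (1 - δ))) ≤ 1 / (16 * Δ ^ 3) := by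
  have h1 : 0 < 1 - δ := by linarith
  have hlogΔ : 0 < Real.log Δ := Real.log_pos (by linarith)
  have hlog : -Real.log (1 - δ) ≤ δ / (1 - δ) := by
    have := Real.one_sub_inv_le_log_of_pos h1
    have heq : δ / (1 - δ) = (1 - δ)⁻¹ - 1 := by field_simp; ring
    linarith
  have hA : -Real.log (1 - δ) * (ℓ / 2) ≤ δ / (1 - δ) * (ℓ / 2) :=
    mul_le_mul_of_nonneg_right hlog (by positivity)
  have hB : (ℓ / (1 - δ) - 1) * δ ≤ μ * δ := mul_le_mul_of_nonneg_right hμ hδ0.le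
  -- The left factor is `7 log Δ / (2δ(1 - δ))` after inserting the value of `δ² ℓ`, and `δ(1 - δ) ≤
  -- 1/4`.
  have hC : 14 * Real.log Δ ≤ δ / (1 - δ) * (ℓ / 2) := by
    have heq : δ / (1 - δ) * (ℓ / 2) = δ ^ 2 * ℓ / (2 * (δ * (1 - δ))) := by field_simp
    rw [heq, hδ, le_div_iff₀ (by positivity)]
    nlinarith [sq_nonneg (2 * δ - 1)]
  have hD : ℓ / (1 - δ) * δ = 2 * (δ / (1 - δ) * (ℓ / 2)) := by field_simp
  -- The 1 absorbs the loss `δ` coming from the `- 1` in the lower bound for `μ`.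
  calc _ ≤ Real.exp (1 + -((14 : ℕ) * Real.log Δ)) := by
        refine Real.exp_le_exp.2 ?_
        push_cast
        linarith
    _ = Real.exp 1 / Δ ^ 14 := by
        rw [Real.exp_add, Real.exp_neg, ← Real.log_pow, Real.exp_log (by positivity), div_eq_mul_inv]
    _ ≤ 3 / Δ ^ 14 := by
        refine div_le_div_of_nonneg_right ?_ (by positivity)
        linarith [Real.exp_one_lt_d9]
    _ ≤ _ := by
        rw [div_le_div_iff₀ (by positivity) (by positivity)]
        have h48 : (48 : ℝ) ≤ Δ ^ 11 := by
          calc (48 : ℝ) ≤ Δ := by linarith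
            _ ≤ Δ ^ 11 := le_self_pow₀ (by linarith) (by norm_num)
        calc 3 * (16 * Δ ^ 3) = 48 * Δ ^ 3 := by ring
          _ ≤ Δ ^ 11 * Δ ^ 3 := mul_le_mul_of_nonneg_right h48 (by positivity)
          _ = _ := by ring

end HardCore

theorem theorem6 {V : Type*} [Fintype V] (G : SimpleGraph V) [DecidableRel G.Adj]
    (Δ : ℕ) (hG : G.maxDegree = Δ) (hΔ : 2 ^ 6 ≤ Δ)
    (lam β γ : ℝ) (hlam : 0 < lam) (hβ : 0 < β) (hγ : 0 < γ)
    (hocc : HardCore.StrongLocalOccupancy G lam β γ)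
    (ℓ : ℝ) (hℓ : 7 * Real.log Δ < ℓ)
    (hZ : HardCore.NeighborhoodPartitionBound G lam (ℓ / 8) (8 * (Δ : ℝ) ^ 4))
    (r q : ℝ)
    (hr : r = lam / (1 + lam) * (ℓ / (1 - Real.sqrt (7 * Real.log Δ / ℓ))))
    (hq : q = r * (β + γ * (Δ / r))) :
    (HardCore.listChromaticNumber G : ℝ) ≤ q := by
  classical
  set δ : ℝ := Real.sqrt (7 * Real.log Δ / ℓ) with hδdef
  have hΔR : (64 : ℝ) ≤ Δ := by exact_mod_cast hΔ
  have hlogΔ : 0 < Real.log Δ := Real.log_pos (by linarith)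
  have hℓ0 : 0 < ℓ := by linarith
  have hδ0 : 0 < δ := Real.sqrt_pos.2 (by positivity)
  have hδsq : δ ^ 2 * ℓ = 7 * Real.log Δ := by
    rw [hδdef, Real.sq_sqrt (by positivity), div_mul_cancel₀ _ hℓ0.ne']
  have hδ1 : δ < 1 := by
    rw [hδdef, Real.sqrt_lt' one_pos, one_pow, div_lt_one hℓ0]
    exact hℓ
  have h1δ : 0 < 1 - δ := by linarith
  have hr0 : 0 < r := by rw [hr]; positivity
  have hq' : q = β * (lam / (1 + lam)) * (ℓ / (1 - δ)) + γ * Δ := by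
    rw [hq, mul_add, hr]
    have : r * (γ * (Δ / r)) = γ * Δ := by field_simp
    rw [← hr, this, hr]
    ring
  have hq0 : 0 ≤ q := by rw [hq']; positivity
  set b : ℝ := β * (lam / (1 + lam)) with hb
  set k : ℕ := ⌊q⌋₊ with hk
  have hkq : (k : ℝ) ≤ q := Nat.floor_le hq0
  have hqk : q < k + 1 := Nat.lt_floor_add_one q
  refine le_trans (Nat.cast_le.2 (Nat.sInf_le (m := k) ?_)) hkq
  -- In the second case `k ≤ Δ`, which bounds the number of colours in the union bound behind `p`.
  rcases lt_or_ge Δ k with hΔk | hkΔ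
  · exact HardCore.listColorable_of_maxDegree_lt (hG ▸ hΔk)
  intro L hL
  have hdeg : ∀ v, G.degree v ≤ Δ := fun v => hG ▸ G.degree_le_maxDegree v
  have hoccF := fun u F (hF : F ⊆ G.neighborFinset u) =>
    HardCore.indepSum_le_of_strongLocalOccupancy hlam hocc u hF
  have hZF := fun u F (hF : F ⊆ G.neighborFinset u) =>
    HardCore.le_indepSum_of_neighborhoodPartitionBound hZ u hF
  have hM : (0 : ℝ) < 8 * (Δ : ℝ) ^ 4 := by positivity
  set p : ℝ := 1 / (16 * (Δ : ℝ) ^ 3) + Δ / (8 * (Δ : ℝ) ^ 4) with hp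
  have hpair : ∀ (u : V) (e : (V → Option ℕ) → ℝ), (∀ σ, 0 ≤ e σ) →
      (∀ σ τ, (∀ v ∉ G.neighborFinset u, σ v = τ v) → e σ = e τ) →
      ∑ σ ∈ HardCore.partialColorings G L with HardCore.Deficient G L (4 * (ℓ / 8)) (ℓ / 8) u σ,
        HardCore.weight lam σ * e σ ≤
          p * ∑ σ ∈ HardCore.partialColorings G L, HardCore.weight lam σ * e σ := by
    intro u e he0 he
    have hW : 0 ≤ ∑ σ ∈ HardCore.partialColorings G L, HardCore.weight lam σ * e σ :=
      Finset.sum_nonneg fun σ _ => mul_nonneg (pow_nonneg hlam.le _) (he0 σ)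
    -- Occupancy for the empty subgraph. Hence rounding `q` down, which costs less than 1, costs
    -- less than 1 in `μ` after division by `b`.
    have hb1 : 1 ≤ b := by
      have := hoccF u ∅ (Finset.empty_subset _)
      simpa [HardCore.indepSum, HardCore.indepSubsets, Finset.filter_singleton] using this
    have hμ : ℓ / (1 - δ) - 1 ≤
        ((L u).card - γ * (G.neighborFinset u).card) / b := by
      rw [le_div_iff₀ (by linarith), hL u]
      have hγN : γ * (G.neighborFinset u).card ≤ γ * Δ :=
        mul_le_mul_of_nonneg_left (by exact_mod_cast hdeg u) hγ.le
      nlinarith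
    have hfew := HardCore.sum_few_unused_le (L := L) hlam (G.neighborFinset u) (L u)
      (show 0 < b by linarith) hγ.le (hoccF u) e he0 he (a := 4 * (ℓ / 8)) h1δ (by linarith)
    rw [show 4 * (ℓ / 8) = ℓ / 2 by ring] at hfew ⊢
    have hfew' := hfew.trans (mul_le_mul_of_nonneg_right
      (HardCore.exp_tail_le hΔR hℓ0 hδ0 hδ1 hδsq hμ) hW)
    refine (HardCore.sum_deficient_le hlam u hM (hZF u) e he0 he hfew').trans ?_
    refine mul_le_mul_of_nonneg_right ?_ hW
    rw [hp, hL u]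
    gcongr
  set d : ℕ := Δ * (Δ + Δ * Δ) with hd
  have hdR : (d : ℝ) = (Δ : ℝ) ^ 2 + (Δ : ℝ) ^ 3 := by rw [hd]; push_cast; ring
  have hd1 : (1 : ℝ) ≤ d := by rw [hdR]; nlinarith [pow_pos (show (0 : ℝ) < Δ by linarith) 3]
  -- The local lemma is used with `x = 1 / (2d)`: Bernoulli gives `(1 - x) ^ d ≥ 1/2`, so `p ≤ 1 /
  -- (4d)` suffices, and `p = 3 / (16Δ³)` meets this as soon as `Δ ≥ 3`.
  have hx1 : (1 : ℝ) / (2 * d) ≤ 1 / 2 := by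
    rw [div_le_div_iff₀ (by positivity) (by norm_num)]; linarith
  have hpow : (1 : ℝ) / 2 ≤ (1 - 1 / (2 * d)) ^ d := by
    have := one_add_mul_le_pow (a := -(1 / (2 * d) : ℝ)) (by linarith) d
    have heq : (1 : ℝ) + d * -(1 / (2 * d)) = 1 / 2 := by field_simp; norm_num
    rw [heq] at this
    exact this
  have hpx : p ≤ 1 / (2 * d) * (1 - 1 / (2 * d)) ^ d := by
    have hle : p ≤ 1 / (2 * d) * (1 / 2) := by
      have hΔ0 : (0 : ℝ) < Δ := by linarith
      have hpe : p = 3 / (16 * (Δ : ℝ) ^ 3) := by rw [hp]; field_simp; norm_num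
      rw [hpe, div_mul_div_comm, one_mul, div_le_div_iff₀ (by positivity) (by positivity), hdR]
      nlinarith [pow_pos hΔ0 2]
    exact hle.trans (mul_le_mul_of_nonneg_left hpow (by positivity))
  obtain ⟨σ, hσ, hσd⟩ := HardCore.exists_partialColoring_not_deficient hlam (by positivity)
    (by linarith) hpx (HardCore.card_walkNeighbors_le hdeg) hpair
  exact HardCore.exists_coloring_of_not_deficient (by positivity) hσ hσd
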